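/- Let $k$ be a field of characteristic $0$ and let $H$, $K$ be cocommutative Hopf algebras over $k$ which are conilpotent (for instance graded connected, or universal enveloping algebras of Lie algebras): every element lies in some step of the exhaustive filtration $F_0=k1$, $F_{n+1}=\{h:\bar\Delta(h)\in F_n\otimes F_n\}$, where $\bar\Delta(h)=\Delta(h)-h\otimes 1-1\otimes h+\varepsilon(h)\,1\otimes 1$. Let $(H,\triangleleft,K)$ be a right Hopf module, i.e. $\triangleleft$ is a (unital, associative) right action of the algebra $K$ on $H$ with $$(h_1h_2)\triangleleft a=(h_1\triangleleft a_{(1)})(h_2\triangleleft a_{(2)}),\qquad \Delta(h\triangleleft a)=(h_{(1)}\triangleleft a_{(1)})\otimes(h_{(2)}\triangleleft a_{(2)}),\qquad S_H(h\triangleleft a)=S_H(h)\triangleleft a .$$ For linear maps $A,B:H\to K$ put $$(A\# B)(f)=A\big(f_{(1)}\triangleleft S_K(B(f_{(2)})_{(1)})\big)\,B(f_{(2)})_{(2)},$$ and let $\alpha^{\#0}=\eta_K\circ\varepsilon_H$, $\alpha^{\#(n+1)}=\alpha^{\# n}\#\alpha$. Let $\delta$ be the space of $\varepsilon$-co-cocycles,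 that is, of linear maps $\alpha:H\to K$ with $\Delta_K\circ\alpha=(\eta_K\varepsilon_H\otimes\alpha+\alpha\otimes\eta_K\varepsilon_H)\circ\Delta_H$ and $\alpha(1_H)=0$. Let $G_\#$ be the set of coalgebra morphisms $H\to K$. Then: 1. $G_\#$ is a group for the product $\#$, with unit $\eta_K\circ\varepsilon_H$. 2. For all $\alpha\in\delta$ and $f\in H$, one has $\alpha^{\# n}(f)=0$ for all but finitely many $n$, so that $$\exp_\#(\alpha)=\eta_K\circ\varepsilon_H+\sum_{n\ge 1}\frac{1}{n!}\,\alpha^{\# n}$$ is a well-defined linear map $H\to K$. 3. $\exp_\#$ is a bijection from $\delta$ onto $G_\#$. -/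

import Mathlib

open TensorProduct

noncomputable section

namespace HopfExp

universe u v w

section Conilpotent

variable (k : Type u) (H : Type v) [Field k] [Ring H] [HopfAlgebra k H]

/-- The reduced coproduct `h ↦ Δ h - h ⊗ 1 - 1 ⊗ h + ε(h) 1 ⊗ 1`, that is,
`((id - η ∘ ε) ⊗ (id - η ∘ ε)) ∘ Δ`. -/
def reducedComul : H →ₗ[k] H ⊗[k] H :=
  Coalgebra.comul - (TensorProduct.mk k H H).flip 1 - TensorProduct.mk k H H 1
    + (LinearMap.toSpanSingleton k (H ⊗[k] H) (1 ⊗ₜ[k] 1)) ∘ₗ Coalgebra.counit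

/-- The filtration of `H` by iterated reduced coproducts: `F 0 = k 1`, and `F (n + 1)` consists of
the elements whose reduced coproduct lies in (the image of) `F n ⊗ F n`. -/
def primFiltration : ℕ → Submodule k H
  | 0 => Submodule.span k {1}
  | n + 1 => (LinearMap.range (TensorProduct.map
      (primFiltration n).subtype (primFiltration n).subtype)).comap (reducedComul k H)

/-- `H` is conilpotent (connected): its filtration by iterated reduced coproducts is exhaustive. -/
def IsConilpotent : Prop := ∀ h : H, ∃ n : ℕ, h ∈ primFiltration k H n

end Conilpotent

variable (k : Type u) (H : Type v) (K : Type w) [Field k] [Ring H] [HopfAlgebra k H]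
  [Ring K] [HopfAlgebra k K]

/-- The structure of a right Hopf module `(H, ◁, K)`: a right action `h ◁ a = act h a` of the
algebra `K` on `H` which is compatible with the product, the coproduct and the antipode of `H`. -/
structure RightHopfModule where
  /-- the action, `act h a = h ◁ a` -/
  act : H →ₗ[k] K →ₗ[k] H
  act_one : ∀ h : H, act h 1 = h
  act_mul : ∀ (h : H) (a b : K), act h (a * b) = act (act h a) b
  /-- `(h₁ h₂) ◁ a = (h₁ ◁ a₍₁₎) (h₂ ◁ a₍₂₎)` -/
  mul_act : ∀ (h₁ h₂ : H) (a : K), act (h₁ * h₂) a =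
    LinearMap.mul' k H (TensorProduct.map (act h₁) (act h₂) (Coalgebra.comul a))
  /-- `Δ (h ◁ a) = (h₍₁₎ ◁ a₍₁₎) ⊗ (h₍₂₎ ◁ a₍₂₎)` -/
  comul_act : ∀ (h : H) (a : K), Coalgebra.comul (R := k) (act h a) =
    TensorProduct.map₂ act act (Coalgebra.comul h) (Coalgebra.comul a)
  antipode_act : ∀ (h : H) (a : K),
    HopfAlgebra.antipode k (act h a) = act (HopfAlgebra.antipode k h) a

/-- The convolution unit `h ↦ ε_H(h) 1_K`. -/
def convUnit : H →ₗ[k] K := Algebra.linearMap k K ∘ₗ Coalgebra.counit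

/-- The space `δ` of (normalized) `ε`-co-cocycles from `H` to `K`: linear maps `α` with
`Δ ∘ α = (η ∘ ε ⊗ α + α ⊗ η ∘ ε) ∘ Δ` and `α 1 = 0`. -/
def coCocycles : Submodule k (H →ₗ[k] K) where
  carrier := {α | Coalgebra.comul ∘ₗ α =
      (TensorProduct.map (convUnit k H K) α + TensorProduct.map α (convUnit k H K)) ∘ₗ
        Coalgebra.comul ∧ α 1 = 0}
  add_mem' := by
    rintro a b ⟨ha, ha'⟩ ⟨hb, hb'⟩
    refine ⟨?_, by simp [ha', hb']⟩
    rw [LinearMap.comp_add, ha, hb, TensorProduct.map_add_left, TensorProduct.map_add_right]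
    simp only [LinearMap.add_comp]
    abel
  zero_mem' := by
    refine ⟨?_, rfl⟩
    rw [TensorProduct.map_zero_left, TensorProduct.map_zero_right]
    simp
  smul_mem' := by
    rintro c a ⟨ha, ha'⟩
    refine ⟨?_, by simp [ha']⟩
    rw [LinearMap.comp_smul, ha, TensorProduct.map_smul_left, TensorProduct.map_smul_right,
      ← smul_add, LinearMap.smul_comp]

/-- The set of coalgebra morphisms from `H` to `K`, seen inside the linear maps. -/
def coalgMorphisms : Set (H →ₗ[k] K) := Set.range fun T : H →ₗc[k] K => (T : H →ₗ[k] K)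

namespace RightHopfModule

variable {k H K} (M : RightHopfModule k H K)

/-- The linear map `h ⊗ a ↦ A (h ◁ S(a₍₁₎)) a₍₂₎`. -/
def sharpAux (A : H →ₗ[k] K) : H ⊗[k] K →ₗ[k] K :=
  LinearMap.mul' k K ∘ₗ
    TensorProduct.map
      (A ∘ₗ TensorProduct.lift M.act ∘ₗ
        TensorProduct.map LinearMap.id (HopfAlgebra.antipode k))
      LinearMap.id ∘ₗ
    (TensorProduct.assoc k H K K).symm.toLinearMap ∘ₗ
    TensorProduct.map LinearMap.id Coalgebra.comul

/-- The product `(A # B)(f) = A (f₍₁₎ ◁ S(B(f₍₂₎)₍₁₎)) B(f₍₂₎)₍₂₎` of linear maps. -/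
def sharp (A B : H →ₗ[k] K) : H →ₗ[k] K :=
  M.sharpAux A ∘ₗ TensorProduct.map LinearMap.id B ∘ₗ Coalgebra.comul

/-- The powers for the product `#`. -/
def sharpPow (α : H →ₗ[k] K) : ℕ → (H →ₗ[k] K)
  | 0 => convUnit k H K
  | n + 1 => M.sharp (sharpPow α n) α

/-- At every element of `H`, only finitely many `#`-powers of `α` do not vanish, so that power
series in `α` make sense. -/
def LocallyNilpotent (α : H →ₗ[k] K) : Prop :=
  ∀ f : H, (Function.support fun n : ℕ => (M.sharpPow α n) f).Finite

open Classical in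
/-- The exponential `exp_#(α) = η ∘ ε + ∑_{n ≥ 1} α^{#n} / n!`, computed pointwise, for locally
nilpotent `α` (and `0` by convention for other `α`). -/
def expSharp (α : H →ₗ[k] K) : H →ₗ[k] K :=
  if hα : M.LocallyNilpotent α then
    { toFun := fun f => ∑ᶠ n : ℕ, ((n.factorial : k)⁻¹) • (M.sharpPow α n) f
      map_add' := fun f g => by
        have hs : ∀ x : H,
            (Function.support fun n : ℕ => ((n.factorial : k)⁻¹) • (M.sharpPow α n) x).Finite :=
          fun x => (hα x).subset fun n hn h0 => hn (by
            have h1 : (M.sharpPow α n) x = 0 := h0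
            simp only [h1, smul_zero])
        rw [← finsum_add_distrib (hs f) (hs g)]
        simp only [map_add, smul_add]
      map_smul' := fun c f => by
        simp only [map_smul, RingHom.id_apply]
        rw [smul_finsum]
        exact finsum_congr fun n => smul_comm _ _ _ }
  else 0

end RightHopfModule

end HopfExp

end

/-! For a coalgebra morphism B one has A # B = (A ∘ t_B) * B, where * is convolution and t_B(f) =
f₍₁₎ ◁ S(B f₍₂₎) is a coalgebra endomorphism of H (`sharp_eq_twist`). Since t_{B # C} = t_B ∘ t_C
(`twist_sharpCoalgHom`), associativity of # reduces to that of *. Conilpotency of K forces B 1 = 1,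
so t_B is unipotent for the filtration F_n of H, hence bijective (`twist_bijective`), and S ∘ B ∘
t_B⁻¹ is a left #-inverse of B.

A co-cocycle α is a map with primitive values and α 1 = 0. For such α, A # α = A * α - A ∘ D with D
f = f₍₁₎ ◁ α f₍₂₎ (`sharp_eq_convDeriv`). As D is a coderivation, A ↦ A # α obeys a Leibniz rule. So
Δ ∘ α^{#n} is given by the binomial formula (`comul_comp_sharpPow`), and exp α is a coalgebra
morphism.

On F_{n+1}, A # α only sees F_n when A and α vanish at 1 (`sharp_congr`). Hence α^{#m} vanishes on
F_n for m > n, and if α = β on F_n, then exp α - exp β = α - β on F_{n+1} (`expSharp_sub_expSharp`).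
This triangularity gives injectivity. For surjectivity, if exp α = T on F_n, then T - exp α is
primitive-valued on F_{n+1} (`comul_sub_of_eqOn`). Adding it to α corrects the exponential one step
further, and the corrections converge since the filtration is exhaustive. -/

noncomputable section

open Coalgebra WithConv

namespace HopfExp

universe u v w

/-! ### Convolution with values in a tensor product of algebras -/

section Convolution

variable {R A B C : Type*} [CommSemiring R] [Semiring A] [Algebra R A] [Semiring B] [Algebra R B]
  [AddCommMonoid C] [Module R C] [Coalgebra R C]

/-- `a ↦ a ⊗ 1` as a linear map. -/
abbrev inclLeft (R A B : Type*) [CommSemiring R] [Semiring A] [Algebra R A] [Semiring B]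
    [Algebra R B] : A →ₗ[R] A ⊗[R] B :=
  (Algebra.TensorProduct.includeLeft : A →ₐ[R] A ⊗[R] B).toLinearMap

/-- `b ↦ 1 ⊗ b` as a linear map. -/
abbrev inclRight (R A B : Type*) [CommSemiring R] [Semiring A] [Algebra R A] [Semiring B]
    [Algebra R B] : B →ₗ[R] A ⊗[R] B :=
  (Algebra.TensorProduct.includeRight : B →ₐ[R] A ⊗[R] B).toLinearMap

lemma inclLeft_convMul_inclRight (f : C →ₗ[R] A) (g : C →ₗ[R] B) :
    toConv (inclLeft R A B ∘ₗ f) * toConv (inclRight R A B ∘ₗ g) =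
      toConv (TensorProduct.map f g ∘ₗ comul) := by
  ext c
  simp [(ℛ R c).convMul_apply, ← (ℛ R c).eq]

/-- The two products send c to f c₍₁₎ ⊗ g c₍₂₎ and f c₍₂₎ ⊗ g c₍₁₎, which cocommutativity
identifies. -/
lemma commute_inclLeft_inclRight [IsCocomm R C] (f : C →ₗ[R] A) (g : C →ₗ[R] B) :
    Commute (toConv (inclLeft R A B ∘ₗ f)) (toConv (inclRight R A B ∘ₗ g)) := by
  ext c
  rw [LinearMap.convMul_apply, LinearMap.convMul_apply]
  conv_rhs => rw [← comm_comul R c]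
  rw [← (ℛ R c).eq]
  simp

lemma inclLeft_comp_convMul (f g : C →ₗ[R] A) :
    toConv (inclLeft R A B ∘ₗ (toConv f * toConv g).ofConv) =
      toConv (inclLeft R A B ∘ₗ f) * toConv (inclLeft R A B ∘ₗ g) := by
  rw [LinearMap.algHom_comp_convMul_distrib]

lemma inclRight_comp_convMul (f g : C →ₗ[R] B) :
    toConv (inclRight R A B ∘ₗ (toConv f * toConv g).ofConv) =
      toConv (inclRight R A B ∘ₗ f) * toConv (inclRight R A B ∘ₗ g) := by
  rw [LinearMap.algHom_comp_convMul_distrib]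

@[simp]
lemma inclLeft_comp_convOne :
    toConv (inclLeft R A B ∘ₗ (1 : WithConv (C →ₗ[R] A)).ofConv) = 1 := by
  ext; simp [Algebra.TensorProduct.algebraMap_apply]

@[simp]
lemma inclRight_comp_convOne :
    toConv (inclRight R A B ∘ₗ (1 : WithConv (C →ₗ[R] B)).ofConv) = 1 := by
  ext; simp [Algebra.TensorProduct.one_def, Algebra.algebraMap_eq_smul_one,
    TensorProduct.smul_tmul']

/-- Precomposition with a coderivation is a derivation of the convolution product. -/
lemma convMul_comp_coderivation {D : C →ₗ[R] C}
    (hD : comul ∘ₗ D = (TensorProduct.map D LinearMap.id + TensorProduct.map LinearMap.id D) ∘ₗ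
      comul) (f g : C →ₗ[R] A) :
    toConv ((toConv f * toConv g).ofConv ∘ₗ D) =
      toConv (f ∘ₗ D) * toConv g + toConv f * toConv (g ∘ₗ D) := by
  ext c
  have h := LinearMap.congr_fun hD c
  simp only [LinearMap.comp_apply] at h
  change LinearMap.mul' R A (TensorProduct.map f g (comul (D c))) = _
  rw [h, ← (ℛ R c).eq]
  simp [(ℛ R c).convMul_apply, Finset.sum_add_distrib]

end Convolution

/-! ### Coalgebra morphisms under convolution -/

section CoalgHom

lemma convMul_comp_coalgHom {R A C E : Type*} [CommSemiring R] [Semiring A] [Algebra R A]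
    [AddCommMonoid C] [Module R C] [Coalgebra R C] [AddCommMonoid E] [Module R E] [Coalgebra R E]
    (f g : C →ₗ[R] A) (φ : E →ₗc[R] C) :
    toConv ((toConv f * toConv g).ofConv ∘ₗ (φ : E →ₗ[R] C)) =
      toConv (f ∘ₗ (φ : E →ₗ[R] C)) * toConv (g ∘ₗ (φ : E →ₗ[R] C)) :=
  congrArg toConv (LinearMap.convMul_comp_coalgHom_distrib (toConv f) (toConv g) φ)

variable {R C K : Type*} [CommSemiring R] [AddCommMonoid C] [Module R C] [Coalgebra R C]

section Bialgebra

variable [Semiring K] [Bialgebra R K]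

lemma comul_comp_convMul (X Y : C →ₗ[R] K) :
    toConv (comul ∘ₗ (toConv X * toConv Y).ofConv) =
      toConv (comul ∘ₗ X) * toConv (comul ∘ₗ Y) := by
  have := LinearMap.algHom_comp_convMul_distrib (Bialgebra.comulAlgHom R K) (toConv X) (toConv Y)
  exact congrArg toConv this

lemma comul_comp_coalgHom (X : C →ₗc[R] K) :
    toConv (comul ∘ₗ (X : C →ₗ[R] K)) =
      toConv (inclLeft R K K ∘ₗ (X : C →ₗ[R] K)) * toConv (inclRight R K K ∘ₗ (X : C →ₗ[R] K)) := by
  rw [inclLeft_convMul_inclRight, CoalgHomClass.map_comp_comul]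

/-- The unit of the convolution product as a coalgebra morphism. -/
def convOneCoalgHom : C →ₗc[R] K where
  toLinearMap := Algebra.linearMap R K ∘ₗ counit
  counit_comp := by ext; simp
  map_comp_comul := by
    have h := inclLeft_convMul_inclRight (R := R) (C := C) (A := K) (B := K)
      (Algebra.linearMap R K ∘ₗ counit) (Algebra.linearMap R K ∘ₗ counit)
    apply toConv_injective
    rw [← h]
    have h1 : toConv (inclLeft R K K ∘ₗ Algebra.linearMap R K ∘ₗ counit (R := R) (A := C)) = 1 :=
      inclLeft_comp_convOne
    have h2 : toConv (inclRight R K K ∘ₗ Algebra.linearMap R K ∘ₗ counit (R := R) (A := C)) = 1 :=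
      inclRight_comp_convOne
    rw [h1, h2, one_mul]
    ext; simp [Algebra.TensorProduct.algebraMap_apply]

variable [IsCocomm R C]

/-- The convolution product of two coalgebra morphisms on a cocommutative coalgebra. -/
def convMulCoalgHom (X Y : C →ₗc[R] K) : C →ₗc[R] K where
  toLinearMap := (toConv (X : C →ₗ[R] K) * toConv (Y : C →ₗ[R] K)).ofConv
  counit_comp := by
    have := LinearMap.algHom_comp_convMul_distrib (Bialgebra.counitAlgHom R K)
      (toConv (X : C →ₗ[R] K)) (toConv (Y : C →ₗ[R] K))
    refine this.trans ?_
    have hX : (Bialgebra.counitAlgHom R K).toLinearMap ∘ₗ (X : C →ₗ[R] K) = counit := X.counit_comp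
    have hY : (Bialgebra.counitAlgHom R K).toLinearMap ∘ₗ (Y : C →ₗ[R] K) = counit := Y.counit_comp
    rw [ofConv_toConv, ofConv_toConv, hX, hY]
    have : toConv (counit (R := R) (A := C)) = 1 := by ext; simp
    rw [this, one_mul]; rfl
  map_comp_comul := by
    apply toConv_injective
    rw [comul_comp_convMul, comul_comp_coalgHom, comul_comp_coalgHom, ← inclLeft_convMul_inclRight,
      inclLeft_comp_convMul, inclRight_comp_convMul,
      (commute_inclLeft_inclRight (Y : C →ₗ[R] K) (X : C →ₗ[R] K)).mul_mul_mul_comm]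

end Bialgebra

section Hopf

variable [Semiring K] [HopfAlgebra R K]

lemma antipode_comp_convMul_self (X : C →ₗc[R] K) :
    toConv (HopfAlgebra.antipode R ∘ₗ (X : C →ₗ[R] K)) * toConv (X : C →ₗ[R] K) = 1 := by
  have := LinearMap.convMul_comp_coalgHom_distrib (toConv (HopfAlgebra.antipode R (A := K)))
    (toConv LinearMap.id) X
  rw [LinearMap.antipode_mul_id] at this
  refine (congrArg toConv this.symm).trans ?_
  ext; simp

lemma self_convMul_antipode_comp (X : C →ₗc[R] K) :
    toConv (X : C →ₗ[R] K) * toConv (HopfAlgebra.antipode R ∘ₗ (X : C →ₗ[R] K)) = 1 := by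
  have := LinearMap.convMul_comp_coalgHom_distrib (toConv LinearMap.id)
    (toConv (HopfAlgebra.antipode R (A := K))) X
  rw [LinearMap.id_mul_antipode] at this
  refine (congrArg toConv this.symm).trans ?_
  ext; simp

/-- Both sides are convolution inverses of X * Y, which is a coalgebra morphism by cocommutativity.
-/
lemma antipode_comp_convMul [IsCocomm R C] (X Y : C →ₗc[R] K) :
    toConv (HopfAlgebra.antipode R ∘ₗ (toConv (X : C →ₗ[R] K) * toConv (Y : C →ₗ[R] K)).ofConv) =
      toConv (HopfAlgebra.antipode R ∘ₗ (Y : C →ₗ[R] K)) *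
        toConv (HopfAlgebra.antipode R ∘ₗ (X : C →ₗ[R] K)) := by
  refine left_inv_eq_right_inv (antipode_comp_convMul_self (convMulCoalgHom X Y)) ?_
  change (toConv (X : C →ₗ[R] K) * toConv (Y : C →ₗ[R] K)) * _ = 1
  rw [mul_assoc, ← mul_assoc (toConv (Y : C →ₗ[R] K)), self_convMul_antipode_comp, one_mul,
    self_convMul_antipode_comp]

variable (R K) in
/-- The antipode of a cocommutative Hopf algebra as a coalgebra morphism. -/
def antipodeCoalgHom [IsCocomm R K] : K →ₗc[R] K where
  toLinearMap := HopfAlgebra.antipode R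
  counit_comp := HopfAlgebra.counit_comp_antipode
  map_comp_comul := by
    apply toConv_injective
    -- (S ⊗ S) ∘ Δ and Δ ∘ S are both convolution inverses of Δ among the maps K → K ⊗ K.
    refine left_inv_eq_right_inv (a := toConv comul) ?_ LinearMap.comul_right_inv
    have h := comul_comp_coalgHom (CoalgHom.id R K)
    have h1 := LinearMap.antipode_mul_id (R := R) (C := K)
    have hl := inclLeft_comp_convMul (B := K) (HopfAlgebra.antipode R (A := K)) LinearMap.id
    have hr := inclRight_comp_convMul (A := K) (HopfAlgebra.antipode R (A := K)) LinearMap.id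
    rw [h1] at hl hr
    have h' : toConv (comul (R := R) (A := K)) =
      toConv (inclLeft R K K ∘ₗ LinearMap.id) * toConv (inclRight R K K ∘ₗ LinearMap.id) := h
    rw [h', ← inclLeft_convMul_inclRight,
      (commute_inclLeft_inclRight LinearMap.id
        (HopfAlgebra.antipode R (A := K))).symm.mul_mul_mul_comm,
      ← hl, ← hr, inclLeft_comp_convOne, inclRight_comp_convOne, one_mul]

end Hopf

end CoalgHom

/-! ### A Leibniz rule for convolution twisted by a coderivation -/

section ConvDeriv

variable {R A C : Type*} [CommRing R] [Ring A] [Algebra R A] [AddCommGroup C] [Module R C]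
  [Coalgebra R C]

/-- The operator `X ↦ X * β - X ∘ D` on linear maps, where `*` is the convolution product. -/
def convDeriv (β : C →ₗ[R] A) (D : C →ₗ[R] C) : (C →ₗ[R] A) →+ (C →ₗ[R] A) :=
  AddMonoidHom.mk' (fun X => (toConv X * toConv β).ofConv - X ∘ₗ D) fun X Y => by
    rw [toConv_add, add_mul, ofConv_add, LinearMap.add_comp]
    abel

lemma convDeriv_apply (β : C →ₗ[R] A) (D : C →ₗ[R] C) (X : C →ₗ[R] A) :
    convDeriv β D X = (toConv X * toConv β).ofConv - X ∘ₗ D :=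
  rfl

lemma algHom_comp_convDeriv {B : Type*} [Ring B] [Algebra R B] (i : A →ₐ[R] B) (β : C →ₗ[R] A)
    (D : C →ₗ[R] C) (X : C →ₗ[R] A) :
    i.toLinearMap ∘ₗ convDeriv β D X = convDeriv (i.toLinearMap ∘ₗ β) D (i.toLinearMap ∘ₗ X) := by
  rw [convDeriv_apply, LinearMap.comp_sub, LinearMap.algHom_comp_convMul_distrib]
  rfl

/-- Commutation lets β move past Y to act on X. Two maps β, γ occur because Δ ∘ α splits as α ⊗ 1 +
1 ⊗ α for primitive-valued α. -/
lemma convDeriv_convMul {D : C →ₗ[R] C}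
    (hD : comul ∘ₗ D = (TensorProduct.map D LinearMap.id + TensorProduct.map LinearMap.id D) ∘ₗ
      comul) {β γ X Y : C →ₗ[R] A} (h : Commute (toConv β) (toConv Y)) :
    convDeriv (β + γ) D (toConv X * toConv Y).ofConv =
      (toConv (convDeriv β D X) * toConv Y).ofConv +
        (toConv X * toConv (convDeriv γ D Y)).ofConv := by
  apply toConv_injective
  simp only [convDeriv_apply, toConv_sub, toConv_add, convMul_comp_coderivation hD, toConv_ofConv,
    mul_add, sub_mul, mul_sub, mul_assoc, h.eq]
  abel

lemma convDeriv_map_comp_comul [IsCocomm R C] {B : Type*} [Ring B] [Algebra R B] {D : C →ₗ[R] C}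
    (hD : comul ∘ₗ D = (TensorProduct.map D LinearMap.id + TensorProduct.map LinearMap.id D) ∘ₗ
      comul) (β X : C →ₗ[R] A) (γ Y : C →ₗ[R] B) :
    convDeriv (inclLeft R A B ∘ₗ β + inclRight R A B ∘ₗ γ) D (TensorProduct.map X Y ∘ₗ comul) =
      TensorProduct.map (convDeriv β D X) Y ∘ₗ comul +
        TensorProduct.map X (convDeriv γ D Y) ∘ₗ comul := by
  apply toConv_injective
  rw [← ofConv_toConv (TensorProduct.map X Y ∘ₗ comul), ← inclLeft_convMul_inclRight,
    convDeriv_convMul hD (commute_inclLeft_inclRight β Y), toConv_add, toConv_add,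
    toConv_ofConv, toConv_ofConv, ← inclLeft_convMul_inclRight, ← inclLeft_convMul_inclRight,
    algHom_comp_convDeriv, algHom_comp_convDeriv]

end ConvDeriv

variable {k : Type u} {H : Type v} {K : Type w} [Field k] [Ring H] [HopfAlgebra k H]
  [Ring K] [HopfAlgebra k K]

/-! ### The action: counit compatibility and convolution form -/

namespace RightHopfModule

variable (M : RightHopfModule k H K)

/-- Acting by a on h₍₁₎ S(h₍₂₎) = ε(h) 1 gives (h ◁ a)₍₁₎ S((h ◁ a)₍₂₎), by compatibility with
product, antipode and coproduct. -/
lemma counit_smul_one_act (h : H) (a : K) :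
    counit (R := k) h • M.act 1 a = counit (R := k) (M.act h a) • (1 : H) := by
  have h1 : M.act (LinearMap.mul' k H ((HopfAlgebra.antipode k).lTensor H (comul h))) a =
      LinearMap.mul' k H ((HopfAlgebra.antipode k).lTensor H (comul (M.act h a))) := by
    rw [M.comul_act, ← (ℛ k h).eq]
    simp only [map_sum, LinearMap.sum_apply, LinearMap.lTensor_tmul, LinearMap.mul'_apply,
      M.mul_act]
    refine Finset.sum_congr rfl fun i _ => ?_
    rw [← (ℛ k a).eq]
    simp [M.antipode_act]
  simpa [Algebra.algebraMap_eq_smul_one] using h1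

lemma one_act_eq (a : K) : M.act 1 a = counit (R := k) (M.act 1 a) • (1 : H) := by
  simpa using M.counit_smul_one_act 1 a

/-- The functional χ(a) = ε(1 ◁ a) is a character of K, so χ ∘ S is a convolution inverse of it.
From 1 · 1 = 1 it is also convolution-idempotent, hence the convolution unit ε. -/
lemma counit_one_act (a : K) : counit (R := k) (M.act 1 a) = counit (R := k) a := by
  set χ : K →ₗ[k] k := counit ∘ₗ M.act 1 with hχ
  have hmul : ∀ a b, χ (a * b) = χ a * χ b := fun a b => by
    simp only [hχ, LinearMap.comp_apply, M.act_mul]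
    rw [M.one_act_eq a]
    simp
  have hconv : toConv χ * toConv χ = toConv χ := by
    ext a
    have h := congrArg (counit (R := k)) (M.mul_act 1 1 a)
    rw [mul_one, ← (ℛ k a).eq] at h
    rw [(ℛ k a).convMul_apply]
    simpa [hχ, Bialgebra.counit_mul] using h.symm
  have hinv : toConv χ * toConv (χ ∘ₗ HopfAlgebra.antipode k) = 1 := by
    ext a
    have h := congrArg χ (HopfAlgebra.sum_mul_antipode_eq_smul (ℛ k a))
    have h1 : χ 1 = 1 := by simp [hχ, M.act_one]
    rw [(ℛ k a).convMul_apply]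
    simpa [hmul, h1] using h
  have h1 : toConv χ = 1 := by
    calc toConv χ = toConv χ * (toConv χ * toConv (χ ∘ₗ HopfAlgebra.antipode k)) := by
          rw [hinv, mul_one]
      _ = 1 := by rw [← mul_assoc, hconv, hinv]
  exact LinearMap.congr_fun (congrArg ofConv h1) a

@[simp]
lemma one_act (a : K) : M.act 1 a = counit (R := k) a • (1 : H) := by
  rw [one_act_eq, counit_one_act]

@[simp]
lemma counit_act (h : H) (a : K) :
    counit (R := k) (M.act h a) = counit (R := k) h * counit (R := k) a := by
  have := congrArg (counit (R := k)) (M.counit_smul_one_act h a)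
  simpa using this.symm

/-- The action as a coalgebra morphism. -/
def actCoalgHom : H ⊗[k] K →ₗc[k] H where
  toLinearMap := TensorProduct.lift M.act
  counit_comp := by ext h a; simp [mul_comm]
  map_comp_comul := by
    ext h a
    simp only [AlgebraTensorModule.curry_apply, LinearMap.restrictScalars_self, curry_apply,
      LinearMap.comp_apply, lift.tmul, M.comul_act, TensorProduct.comul_tmul]
    rw [← (ℛ k h).eq, ← (ℛ k a).eq]
    simp [TensorProduct.sum_tmul, TensorProduct.tmul_sum]

section ConvAct

variable {C : Type*} [AddCommGroup C] [Module k C] [Coalgebra k C]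

/-- The action of linear maps `U : C → K` on linear maps `g : C → H` by convolution,
`f ↦ g f₍₁₎ ◁ U f₍₂₎`. -/
def convAct (g : C →ₗ[k] H) (U : C →ₗ[k] K) : C →ₗ[k] H :=
  TensorProduct.lift M.act ∘ₗ TensorProduct.map g U ∘ₗ comul

lemma convAct_apply (g : C →ₗ[k] H) (U : C →ₗ[k] K) {c : C} {ι : Type*} (r : Repr k c ι) :
    M.convAct g U c = ∑ i ∈ r.index, M.act (g (r.left i)) (U (r.right i)) := by
  simp [convAct, ← r.eq]

lemma convAct_convOne (g : C →ₗ[k] H) :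
    M.convAct g (Algebra.linearMap k K ∘ₗ counit) = g := by
  ext c
  have h := congrArg g (congrArg (TensorProduct.rid k C) (sum_tmul_counit_eq (R := k) (ℛ k c)))
  simp only [map_sum, TensorProduct.rid_tmul, map_smul, one_smul] at h
  rw [M.convAct_apply g _ (ℛ k c)]
  simpa only [LinearMap.comp_apply, Algebra.linearMap_apply, Algebra.algebraMap_eq_smul_one,
    map_smul, M.act_one] using h

/-- Associativity of the action and coassociativity make the maps C → H a right module over the
convolution algebra of maps C → K. -/
lemma convAct_convAct (g : C →ₗ[k] H) (U V : C →ₗ[k] K) :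
    M.convAct (M.convAct g U) V = M.convAct g (toConv U * toConv V).ofConv := by
  have h : TensorProduct.lift M.act ∘ₗ TensorProduct.map (TensorProduct.lift M.act) LinearMap.id =
      TensorProduct.lift M.act ∘ₗ TensorProduct.map LinearMap.id (LinearMap.mul' k K) ∘ₗ
        (TensorProduct.assoc k H K K).toLinearMap := by
    ext x a b
    simp [M.act_mul]
  calc M.convAct (M.convAct g U) V = (TensorProduct.lift M.act ∘ₗ
        TensorProduct.map (TensorProduct.lift M.act) LinearMap.id) ∘ₗ
        TensorProduct.map (TensorProduct.map g U ∘ₗ comul) V ∘ₗ comul := by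
        simp only [convAct, coassoc_simps]
    _ = _ := by
        rw [h]
        simp only [convAct, LinearMap.convMul_def, coassoc_simps]

lemma convAct_comp_coalgHom {E : Type*} [AddCommGroup E] [Module k E] [Coalgebra k E]
    (g : C →ₗ[k] H) (U : C →ₗ[k] K) (φ : E →ₗc[k] C) :
    M.convAct g U ∘ₗ (φ : E →ₗ[k] C) =
      M.convAct (g ∘ₗ (φ : E →ₗ[k] C)) (U ∘ₗ (φ : E →ₗ[k] C)) := by
  simp only [convAct, LinearMap.comp_assoc, ← CoalgHomClass.map_comp_comul, TensorProduct.map_comp]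

/-- The convolution action of a coalgebra morphism on a coalgebra morphism is one, on a
cocommutative coalgebra. -/
def convActCoalgHom [IsCocomm k C] (g : C →ₗc[k] H) (U : C →ₗc[k] K) : C →ₗc[k] H :=
  (M.actCoalgHom.comp (Coalgebra.TensorProduct.map g U)).comp (comulCoalgHom k C)

end ConvAct

/-- The convolution action of a map with primitive values on the identity is a coderivation. -/
lemma comul_comp_convAct_id [IsCocomm k H] (α : H →ₗ[k] K)
    (hα : ∀ f, comul (R := k) (α f) = 1 ⊗ₜ α f + α f ⊗ₜ 1) :
    comul ∘ₗ M.convAct LinearMap.id α =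
      (TensorProduct.map (M.convAct LinearMap.id α) LinearMap.id +
        TensorProduct.map LinearMap.id (M.convAct LinearMap.id α)) ∘ₗ comul := by
  set D := M.convAct LinearMap.id α with hD
  have hright : TensorProduct.map LinearMap.id D ∘ₗ comul =
      TensorProduct.map LinearMap.id
        (TensorProduct.lift M.act ∘ₗ TensorProduct.map LinearMap.id α) ∘ₗ
        (TensorProduct.assoc k H H H).toLinearMap ∘ₗ TensorProduct.map comul LinearMap.id ∘ₗ
          comul := by
    simp only [hD, convAct, coassoc_simps]
  have hleft : TensorProduct.map D LinearMap.id ∘ₗ comul =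
      (TensorProduct.comm k H H).toLinearMap ∘ₗ TensorProduct.map LinearMap.id D ∘ₗ comul := by
    ext f
    rw [LinearMap.comp_apply, ← comm_comul k f, TensorProduct.map_comm]
    rfl
  -- Since α g is primitive, Δ(f ◁ α g) is f₍₁₎ ⊗ (f₍₂₎ ◁ α g) plus, by cocommutativity, its flip.
  have hL : ∀ f g : H, comul (R := k) (M.act f (α g)) =
      TensorProduct.map LinearMap.id (TensorProduct.lift M.act ∘ₗ TensorProduct.map LinearMap.id α)
        (TensorProduct.assoc k H H H (comul f ⊗ₜ g)) +
      TensorProduct.comm k H H (TensorProduct.map LinearMap.id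
        (TensorProduct.lift M.act ∘ₗ TensorProduct.map LinearMap.id α)
        (TensorProduct.assoc k H H H (comul f ⊗ₜ g))) := fun f g => by
    rw [M.comul_act, hα, map_add]
    congr 1
    · rw [← (ℛ k f).eq]
      simp [TensorProduct.sum_tmul, M.act_one]
    · conv_rhs => rw [← comm_comul k f]
      rw [← (ℛ k f).eq]
      simp [TensorProduct.sum_tmul, M.act_one]
  rw [LinearMap.add_comp, hleft, hright]
  ext f
  conv_lhs => rw [LinearMap.comp_apply, hD, M.convAct_apply _ _ (ℛ k f)]
  simp only [LinearMap.add_apply, LinearMap.comp_apply]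
  rw [← (ℛ k f).eq]
  simp [hL, Finset.sum_add_distrib, add_comm]

end RightHopfModule

/-! ### The conilpotency filtration -/

section Filtration

lemma reducedComul_apply (f : H) :
    reducedComul k H f = comul f - f ⊗ₜ[k] 1 - 1 ⊗ₜ[k] f +
      counit (R := k) f • ((1 : H) ⊗ₜ[k] (1 : H)) :=
  rfl

lemma map_range_map_subtype_mem {V : Type*} [AddCommGroup V] [Module k V] {P Q : Submodule k H}
    {W : Submodule k V} {L : H ⊗[k] H →ₗ[k] V} (hL : ∀ x ∈ P, ∀ y ∈ Q, L (x ⊗ₜ y) ∈ W)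
    {t : H ⊗[k] H} (ht : t ∈ LinearMap.range (TensorProduct.map P.subtype Q.subtype)) :
    L t ∈ W := by
  obtain ⟨s, rfl⟩ := ht
  induction s with
  | zero => simp
  | tmul x y => exact hL x x.2 y y.2
  | add a b ha hb =>
    rw [map_add, map_add]
    exact W.add_mem ha hb

lemma tmul_mem_range_map_subtype {P Q : Submodule k H} {x y : H} (hx : x ∈ P) (hy : y ∈ Q) :
    x ⊗ₜ[k] y ∈ LinearMap.range (TensorProduct.map P.subtype Q.subtype) :=
  ⟨⟨x, hx⟩ ⊗ₜ ⟨y, hy⟩, rfl⟩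

lemma mem_primFiltration_succ {n : ℕ} {f : H} :
    f ∈ primFiltration k H (n + 1) ↔ reducedComul k H f ∈ LinearMap.range (TensorProduct.map
      (primFiltration k H n).subtype (primFiltration k H n).subtype) :=
  Iff.rfl

lemma one_mem_primFiltration (n : ℕ) : (1 : H) ∈ primFiltration k H n := by
  cases n with
  | zero => exact Submodule.mem_span_singleton_self 1
  | succ n =>
    have : reducedComul k H 1 = 0 := by
      simp [reducedComul_apply, Algebra.TensorProduct.one_def]
    rw [mem_primFiltration_succ, this]
    exact Submodule.zero_mem _

lemma primFiltration_le_succ (n : ℕ) : primFiltration k H n ≤ primFiltration k H (n + 1) := by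
  induction n with
  | zero =>
    rw [primFiltration, Submodule.span_singleton_le_iff_mem]
    exact one_mem_primFiltration 1
  | succ n ih =>
    intro f hf
    rw [mem_primFiltration_succ] at hf ⊢
    exact map_range_map_subtype_mem (L := LinearMap.id)
      (fun x hx y hy => tmul_mem_range_map_subtype (ih hx) (ih hy)) hf

lemma primFiltration_mono : Monotone (primFiltration k H) :=
  monotone_nat_of_le_succ primFiltration_le_succ

/-- A linear map on `H ⊗ H` which is known on `F n ⊗ F n`, on `F (n + 1) ⊗ 1` and on
`1 ⊗ F (n + 1)` is known on `Δ (F (n + 1))`. -/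
lemma map_comul_mem {V : Type*} [AddCommGroup V] [Module k V] {W : Submodule k V}
    {L : H ⊗[k] H →ₗ[k] V} {n : ℕ} {f : H} (hf : f ∈ primFiltration k H (n + 1))
    (hL : ∀ x ∈ primFiltration k H n, ∀ y ∈ primFiltration k H n, L (x ⊗ₜ y) ∈ W)
    (hf1 : L (f ⊗ₜ 1 + 1 ⊗ₜ f) ∈ W) : L (comul f) ∈ W := by
  have h : comul f = reducedComul k H f + (f ⊗ₜ[k] 1 + 1 ⊗ₜ[k] f) -
      counit (R := k) f • ((1 : H) ⊗ₜ[k] (1 : H)) := by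
    rw [reducedComul_apply]; abel
  rw [h, map_sub, map_add, map_smul]
  exact W.sub_mem (W.add_mem (map_range_map_subtype_mem hL hf) hf1)
    (W.smul_mem _ (hL _ (one_mem_primFiltration n) _ (one_mem_primFiltration n)))

lemma comul_mem_range_map_subtype {n : ℕ} {f : H} (hf : f ∈ primFiltration k H n) :
    comul f ∈ LinearMap.range (TensorProduct.map
      (primFiltration k H n).subtype (primFiltration k H n).subtype) := by
  cases n with
  | zero =>
    obtain ⟨c, rfl⟩ := Submodule.mem_span_singleton.1 hf
    rw [map_smul, Bialgebra.comul_one, Algebra.TensorProduct.one_def]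
    exact Submodule.smul_mem _ _ (tmul_mem_range_map_subtype
      (one_mem_primFiltration 0) (one_mem_primFiltration 0))
  | succ n =>
    refine map_comul_mem (L := LinearMap.id) hf (fun x hx y hy => ?_) (Submodule.add_mem _ ?_ ?_)
    · exact tmul_mem_range_map_subtype (primFiltration_le_succ n hx) (primFiltration_le_succ n hy)
    · exact tmul_mem_range_map_subtype hf (one_mem_primFiltration _)
    · exact tmul_mem_range_map_subtype (one_mem_primFiltration _) hf

/-- The only group-like element of a conilpotent Hopf algebra is `1`. -/
lemma IsConilpotent.eq_one_of_comul_eq (hH : IsConilpotent k H) {g : H}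
    (hg : comul g = g ⊗ₜ[k] g) (hg' : counit (R := k) g = 1) : g = 1 := by
  have hred : reducedComul k H g = (g - 1) ⊗ₜ (g - 1) := by
    rw [reducedComul_apply, hg, hg', TensorProduct.sub_tmul, TensorProduct.tmul_sub,
      TensorProduct.tmul_sub, one_smul]
    abel
  have hstep : ∀ n, g ∈ primFiltration k H (n + 1) → g ∈ primFiltration k H n := fun n hn => by
    suffices g - 1 ∈ primFiltration k H n by
      simpa using Submodule.add_mem _ this (one_mem_primFiltration n)
    by_contra hv
    obtain ⟨φ, hφ⟩ : ∃ φ : Module.Dual k H, φ (g - 1) ≠ 0 := by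
      by_contra! h
      rw [(Module.forall_dual_apply_eq_zero_iff k (g - 1)).1 h] at hv
      exact hv (Submodule.zero_mem _)
    -- Slicing (g - 1) ⊗ (g - 1) ∈ F n ⊗ F n by φ puts a nonzero multiple of g - 1 in F n.
    rw [mem_primFiltration_succ, hred] at hn
    have := map_range_map_subtype_mem (W := primFiltration k H n)
      (L := (TensorProduct.lid k H).toLinearMap ∘ₗ TensorProduct.map φ LinearMap.id)
      (fun x _ y hy => Submodule.smul_mem _ (φ x) hy) hn
    exact hv ((Submodule.smul_mem_iff _ hφ).1 this)
  have h0 : ∀ n, g ∈ primFiltration k H n → g ∈ primFiltration k H 0 := fun n => by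
    induction n with
    | zero => exact id
    | succ n ih => exact fun h => ih (hstep n h)
  obtain ⟨n, hn⟩ := hH g
  obtain ⟨c, rfl⟩ := Submodule.mem_span_singleton.1 (h0 n hn)
  have : c = 1 := by simpa using hg'
  simp [this]

lemma coalgHom_map_one (hK : IsConilpotent k K) (X : H →ₗc[k] K) : X 1 = 1 := by
  refine hK.eq_one_of_comul_eq ?_ ?_
  · rw [← CoalgHomClass.map_comp_comul_apply, Bialgebra.comul_one, Algebra.TensorProduct.one_def]
    rfl
  · rw [CoalgHomClass.counit_comp_apply, Bialgebra.counit_one]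

/-- A linear endomorphism which is the identity on `F 0` and the identity modulo `F n` on
`F (n + 1)` is bijective. -/
lemma bijective_of_sub_mem (hH : IsConilpotent k H) {φ : H →ₗ[k] H}
    (h0 : ∀ f ∈ primFiltration k H 0, φ f = f)
    (hφ : ∀ n, ∀ f ∈ primFiltration k H (n + 1), φ f - f ∈ primFiltration k H n) :
    Function.Bijective φ := by
  constructor
  · rw [← LinearMap.ker_eq_bot, LinearMap.ker_eq_bot']
    have : ∀ n, ∀ f ∈ primFiltration k H n, φ f = 0 → f = 0 := fun n => by
      induction n with
      | zero => exact fun f hf h => (h0 f hf).symm.trans h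
      | succ n ih =>
        intro f hf h
        refine ih f ?_ h
        simpa [h] using hφ n f hf
    intro f hf
    obtain ⟨n, hn⟩ := hH f
    exact this n f hn hf
  · have : ∀ n, ∀ f ∈ primFiltration k H n, ∃ g, φ g = f := fun n => by
      induction n with
      | zero => exact fun f hf => ⟨f, h0 f hf⟩
      | succ n ih =>
        intro f hf
        obtain ⟨g, hg⟩ := ih _ (hφ n f hf)
        exact ⟨f - g, by rw [map_sub, hg]; abel⟩
    intro f
    obtain ⟨n, hn⟩ := hH f
    exact this n f hn

end Filtration

/-! ### Twists and the group of coalgebra morphisms -/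

namespace RightHopfModule

variable (M : RightHopfModule k H K)

lemma map₂_act_tmul_one (f : H) (a : K) :
    TensorProduct.map₂ M.act M.act (f ⊗ₜ 1) (comul a) = M.act f a ⊗ₜ 1 := by
  have h := congrArg (M.act f) (congrArg (TensorProduct.rid k K)
    (sum_tmul_counit_eq (R := k) (ℛ k a)))
  simp only [map_sum, TensorProduct.rid_tmul, map_smul, one_smul] at h
  rw [← h, ← (ℛ k a).eq]
  simp [TensorProduct.sum_tmul, TensorProduct.smul_tmul]

lemma map₂_act_one_tmul (f : H) (a : K) :
    TensorProduct.map₂ M.act M.act (1 ⊗ₜ f) (comul a) = 1 ⊗ₜ M.act f a := by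
  have h := congrArg (M.act f) (congrArg (TensorProduct.lid k K)
    (sum_counit_tmul_eq (R := k) (ℛ k a)))
  simp only [map_sum, TensorProduct.lid_tmul, map_smul, one_smul] at h
  rw [← h, ← (ℛ k a).eq]
  simp [TensorProduct.tmul_sum, TensorProduct.smul_tmul]

/-- All terms of the reduced coproduct are equivariant for the diagonal action, because 1 ◁ a = ε(a)
1. This is why the action preserves the filtration. -/
lemma reducedComul_act (f : H) (a : K) :
    reducedComul k H (M.act f a) =
      TensorProduct.map₂ M.act M.act (reducedComul k H f) (comul a) := by
  simp only [reducedComul_apply, map_add, map_sub, map_smul, LinearMap.add_apply,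
    LinearMap.sub_apply, LinearMap.smul_apply, map₂_act_tmul_one, map₂_act_one_tmul, M.comul_act,
    one_act, counit_act, TensorProduct.smul_tmul', mul_smul]

lemma act_mem_primFiltration {n : ℕ} {f : H} (hf : f ∈ primFiltration k H n) (a : K) :
    M.act f a ∈ primFiltration k H n := by
  induction n generalizing f a with
  | zero =>
    obtain ⟨c, rfl⟩ := Submodule.mem_span_singleton.1 hf
    rw [map_smul, LinearMap.smul_apply, one_act]
    exact Submodule.smul_mem _ _ (Submodule.smul_mem _ _ (one_mem_primFiltration 0))
  | succ n ih =>
    rw [mem_primFiltration_succ, reducedComul_act]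
    refine map_range_map_subtype_mem (L := (TensorProduct.map₂ M.act M.act).flip (comul a))
      (fun x hx y hy => ?_) hf
    rw [LinearMap.flip_apply, ← (ℛ k a).eq]
    simp only [map_sum, TensorProduct.map₂_apply_tmul, TensorProduct.map_tmul]
    exact Submodule.sum_mem _ fun i _ => tmul_mem_range_map_subtype (ih hx _) (ih hy _)

/-- The convolution action on the identity of a map with values in the augmentation ideal which
vanishes at `1` lowers the filtration. -/
lemma convAct_id_mem_primFiltration {U : H →ₗ[k] K} (hU : ∀ f, counit (R := k) (U f) = 0)
    (hU1 : U 1 = 0) {n : ℕ} {f : H} (hf : f ∈ primFiltration k H (n + 1)) :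
    M.convAct LinearMap.id U f ∈ primFiltration k H n := by
  refine map_comul_mem (L := TensorProduct.lift M.act ∘ₗ TensorProduct.map LinearMap.id U) hf
    (fun x hx y _ => M.act_mem_primFiltration hx _) ?_
  simp [hU, hU1]

lemma convAct_id_apply_one (U : H →ₗ[k] K) : M.convAct LinearMap.id U 1 = M.act 1 (U 1) := by
  simp [convAct, Algebra.TensorProduct.one_def]

/-- As Δ ∘ B = (B ⊗ B) ∘ Δ, the formula becomes A(f₍₁₎ ◁ S(B f₍₂₎)) B f₍₃₎. -/
lemma sharp_eq_convMul (A : H →ₗ[k] K) (B : H →ₗc[k] K) :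
    M.sharp A (B : H →ₗ[k] K) =
      (toConv (A ∘ₗ M.convAct LinearMap.id (HopfAlgebra.antipode k ∘ₗ (B : H →ₗ[k] K))) *
        toConv (B : H →ₗ[k] K)).ofConv := by
  have h : TensorProduct.map (LinearMap.id (M := H)) (comul (R := k)) ∘ₗ
      TensorProduct.map LinearMap.id (B : H →ₗ[k] K) = TensorProduct.map LinearMap.id
        (TensorProduct.map (B : H →ₗ[k] K) (B : H →ₗ[k] K)) ∘ₗ
          TensorProduct.map LinearMap.id comul := by
    rw [← TensorProduct.map_comp, ← TensorProduct.map_comp, CoalgHomClass.map_comp_comul]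
  calc M.sharp A (B : H →ₗ[k] K) = LinearMap.mul' k K ∘ₗ
      TensorProduct.map (A ∘ₗ TensorProduct.lift M.act ∘ₗ
        TensorProduct.map LinearMap.id (HopfAlgebra.antipode k)) LinearMap.id ∘ₗ
      (TensorProduct.assoc k H K K).symm.toLinearMap ∘ₗ
      (TensorProduct.map (LinearMap.id (M := H)) (comul (R := k)) ∘ₗ
        TensorProduct.map LinearMap.id (B : H →ₗ[k] K)) ∘ₗ comul := rfl
    _ = _ := by
      rw [h]
      simp only [LinearMap.convMul_def, convAct, coassoc_simps]

variable [IsCocomm k H] [IsCocomm k K]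

/-- The coalgebra endomorphism `f ↦ f₍₁₎ ◁ S (B f₍₂₎)` of `H`. -/
def twist (B : H →ₗc[k] K) : H →ₗc[k] H :=
  M.convActCoalgHom (CoalgHom.id k H) ((antipodeCoalgHom k K).comp B)

lemma coe_twist (B : H →ₗc[k] K) : (M.twist B : H →ₗ[k] H) =
    M.convAct LinearMap.id (HopfAlgebra.antipode k ∘ₗ (B : H →ₗ[k] K)) :=
  rfl

lemma sharp_eq_twist (A : H →ₗ[k] K) (B : H →ₗc[k] K) :
    M.sharp A (B : H →ₗ[k] K) =
      (toConv (A ∘ₗ (M.twist B : H →ₗ[k] H)) * toConv (B : H →ₗ[k] K)).ofConv :=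
  M.sharp_eq_convMul A B

/-- The product `#` of coalgebra morphisms as a coalgebra morphism. -/
def sharpCoalgHom (A B : H →ₗc[k] K) : H →ₗc[k] K :=
  convMulCoalgHom (A.comp (M.twist B)) B

lemma coe_sharpCoalgHom (A B : H →ₗc[k] K) : (M.sharpCoalgHom A B : H →ₗ[k] K) =
    M.sharp (A : H →ₗ[k] K) (B : H →ₗ[k] K) :=
  (M.sharp_eq_twist (A : H →ₗ[k] K) B).symm

/-- The antipode reverses convolution, so S ∘ (B # C) = (S ∘ C) * (S ∘ B ∘ t_C). Acting by the first
factor on the identity yields t_C, and then acting by the second yields t_B ∘ t_C. -/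
lemma twist_sharpCoalgHom (B C : H →ₗc[k] K) :
    (M.twist (M.sharpCoalgHom B C) : H →ₗ[k] H) =
      (M.twist B : H →ₗ[k] H) ∘ₗ (M.twist C : H →ₗ[k] H) := by
  have h : HopfAlgebra.antipode k ∘ₗ (M.sharpCoalgHom B C : H →ₗ[k] K) =
      (toConv (HopfAlgebra.antipode k ∘ₗ (C : H →ₗ[k] K)) *
        toConv ((HopfAlgebra.antipode k ∘ₗ (B : H →ₗ[k] K)) ∘ₗ (M.twist C : H →ₗ[k] H))).ofConv :=
    congrArg ofConv (antipode_comp_convMul (B.comp (M.twist C)) C)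
  rw [M.coe_twist (M.sharpCoalgHom B C), h, M.coe_twist B, M.convAct_comp_coalgHom,
    LinearMap.id_comp, M.coe_twist C, M.convAct_convAct]

lemma sharp_assoc (A : H →ₗ[k] K) (B C : H →ₗc[k] K) :
    M.sharp (M.sharp A (B : H →ₗ[k] K)) (C : H →ₗ[k] K) =
      M.sharp A (M.sharp (B : H →ₗ[k] K) (C : H →ₗ[k] K)) := by
  rw [← coe_sharpCoalgHom, M.sharp_eq_twist _ (M.sharpCoalgHom B C), M.sharp_eq_twist _ C,
    M.sharp_eq_twist A B, convMul_comp_coalgHom, coe_sharpCoalgHom,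
    M.sharp_eq_twist _ C, twist_sharpCoalgHom, toConv_ofConv, mul_assoc]
  rfl

lemma convUnit_sharp (B : H →ₗc[k] K) :
    M.sharp (convUnit k H K) (B : H →ₗ[k] K) = (B : H →ₗ[k] K) := by
  have : convUnit k H K ∘ₗ (M.twist B : H →ₗ[k] H) = convUnit k H K := by
    rw [convUnit, LinearMap.comp_assoc, CoalgHomClass.counit_comp]
  rw [sharp_eq_twist, this]
  exact congrArg ofConv (one_mul (toConv (B : H →ₗ[k] K)))

lemma twist_bijective (hH : IsConilpotent k H) (hK : IsConilpotent k K) (A : H →ₗc[k] K) :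
    Function.Bijective (M.twist A) := by
  -- The unit η ∘ ε acts trivially, so t_A - id is the convolution action of U, which lowers the
  -- filtration.
  set U : H →ₗ[k] K := HopfAlgebra.antipode k ∘ₗ (A : H →ₗ[k] K) - convUnit k H K with hU
  have hU0 : ∀ f, counit (R := k) (U f) = 0 := fun f => by
    simp [hU, convUnit]
  have hU1 : U 1 = 0 := by
    simp [hU, convUnit, coalgHom_map_one hK]
  have hsub : ∀ f, M.twist A f - f = M.convAct LinearMap.id U f := fun f => by
    have h1 := LinearMap.congr_fun (M.convAct_convOne (LinearMap.id (M := H))) f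
    have h2 := LinearMap.congr_fun (M.coe_twist A) f
    refine (congrArg₂ (· - ·) h2 h1.symm).trans ?_
    simp only [M.convAct_apply _ _ (ℛ k f), ← Finset.sum_sub_distrib, ← map_sub]
    rfl
  refine bijective_of_sub_mem (φ := (M.twist A : H →ₗ[k] H)) hH (fun f hf => ?_) fun n f hf => ?_
  · obtain ⟨c, rfl⟩ := Submodule.mem_span_singleton.1 hf
    refine sub_eq_zero.1 ((hsub _).trans ?_)
    rw [map_smul, convAct_id_apply_one, hU1, map_zero, smul_zero]
  · exact (congrArg (· ∈ primFiltration k H n) (hsub f)).mpr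
      (M.convAct_id_mem_primFiltration hU0 hU1 hf)

lemma exists_sharp_eq_convUnit (hH : IsConilpotent k H) (hK : IsConilpotent k K)
    (A : H →ₗc[k] K) :
    ∃ B : H →ₗc[k] K, M.sharp (B : H →ₗ[k] K) (A : H →ₗ[k] K) = convUnit k H K := by
  set e := CoalgEquiv.ofBijective (M.twist_bijective hH hK A)
  refine ⟨((antipodeCoalgHom k K).comp A).comp (e.symm : H →ₗc[k] H), ?_⟩
  rw [sharp_eq_twist]
  refine Eq.trans ?_ (congrArg ofConv (antipode_comp_convMul_self A))
  congr 3
  ext f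
  exact congrArg (fun g => HopfAlgebra.antipode k (A g)) (e.symm_apply_apply f)

/-- The group of coalgebra morphisms under `#`. -/
abbrev coalgMorphismsGroup (hH : IsConilpotent k H) (hK : IsConilpotent k K) :
    Group (coalgMorphisms k H K) :=
  letI : Mul (coalgMorphisms k H K) := ⟨fun A B => ⟨M.sharp A.1 B.1, by
    obtain ⟨_, A, rfl⟩ := A
    obtain ⟨_, B, rfl⟩ := B
    exact ⟨M.sharpCoalgHom A B, M.coe_sharpCoalgHom A B⟩⟩⟩
  letI : One (coalgMorphisms k H K) := ⟨⟨convUnit k H K, convOneCoalgHom, rfl⟩⟩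
  have h : ∀ A : coalgMorphisms k H K, ∃ B : coalgMorphisms k H K, B * A = 1 := by
    rintro ⟨_, A, rfl⟩
    obtain ⟨B, hB⟩ := M.exists_sharp_eq_convUnit hH hK A
    exact ⟨⟨_, B, rfl⟩, Subtype.ext hB⟩
  letI : Inv (coalgMorphisms k H K) := ⟨fun A => (h A).choose⟩
  Group.ofLeftAxioms
    (by
      rintro ⟨_, A, rfl⟩ ⟨_, B, rfl⟩ ⟨_, C, rfl⟩
      exact Subtype.ext (M.sharp_assoc _ B C))
    (by
      rintro ⟨_, A, rfl⟩
      exact Subtype.ext (M.convUnit_sharp A))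
    fun A => (h A).choose_spec

end RightHopfModule

/-! ### Co-cocycles as maps with primitive values -/

section Primitive

lemma counit_eq_zero_of_primitive {p : K} (hp : comul (R := k) p = 1 ⊗ₜ p + p ⊗ₜ 1) :
    counit (R := k) p = 0 := by
  have h := congrArg (TensorProduct.lid k K) (rTensor_counit_comul (R := k) p)
  rw [hp] at h
  simpa using congrArg (counit (R := k)) h

lemma antipode_eq_neg_of_primitive {p : K} (hp : comul (R := k) p = 1 ⊗ₜ p + p ⊗ₜ 1) :
    HopfAlgebra.antipode k p = -p := by
  have h := HopfAlgebra.mul_antipode_rTensor_comul_apply (R := k) p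
  rw [hp, counit_eq_zero_of_primitive hp] at h
  exact eq_neg_of_add_eq_zero_right (by simpa using h)

lemma map_convUnit_comp_comul (α : H →ₗ[k] K) :
    TensorProduct.map (convUnit k H K) α ∘ₗ comul = inclRight k K K ∘ₗ α := by
  apply toConv_injective
  rw [← inclLeft_convMul_inclRight]
  exact (congrArg (· * toConv (inclRight k K K ∘ₗ α)) inclLeft_comp_convOne).trans (one_mul _)

lemma map_comp_convUnit_comul (α : H →ₗ[k] K) :
    TensorProduct.map α (convUnit k H K) ∘ₗ comul = inclLeft k K K ∘ₗ α := by
  apply toConv_injective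
  rw [← inclLeft_convMul_inclRight]
  exact (congrArg (toConv (inclLeft k K K ∘ₗ α) * ·) inclRight_comp_convOne).trans (mul_one _)

/-- By the counit law, the co-cocycle identity becomes a condition on each value of α separately,
which is what makes extensions and limits easy. -/
lemma mem_coCocycles {α : H →ₗ[k] K} : α ∈ coCocycles k H K ↔
    (∀ f, comul (R := k) (α f) = 1 ⊗ₜ α f + α f ⊗ₜ 1) ∧ α 1 = 0 := by
  refine Iff.trans (b := comul ∘ₗ α = (TensorProduct.map (convUnit k H K) α +
    TensorProduct.map α (convUnit k H K)) ∘ₗ comul ∧ α 1 = 0) Iff.rfl ?_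
  rw [LinearMap.add_comp, map_convUnit_comp_comul, map_comp_convUnit_comul, LinearMap.ext_iff]
  rfl

lemma counit_coCocycles_apply {α : H →ₗ[k] K} (hα : α ∈ coCocycles k H K) (f : H) :
    counit (R := k) (α f) = 0 :=
  counit_eq_zero_of_primitive ((mem_coCocycles.1 hα).1 f)

lemma comul_comp_coCocycles {α : H →ₗ[k] K} (hα : α ∈ coCocycles k H K) :
    comul ∘ₗ α = inclLeft k K K ∘ₗ α + inclRight k K K ∘ₗ α := by
  ext f
  exact ((mem_coCocycles.1 hα).1 f).trans (add_comm _ _)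

lemma coCocycles_apply_eq_zero {α : H →ₗ[k] K} (hα : α ∈ coCocycles k H K) {f : H}
    (hf : f ∈ primFiltration k H 0) : α f = 0 := by
  obtain ⟨c, rfl⟩ := Submodule.mem_span_singleton.1 hf
  rw [map_smul, (mem_coCocycles.1 hα).2, smul_zero]

end Primitive

/-! ### Powers of a co-cocycle -/

namespace RightHopfModule

variable (M : RightHopfModule k H K)

/-- For p = α f₍₂₎ primitive, Δ p = 1 ⊗ p + p ⊗ 1 and S p = -p leave just two terms. -/
lemma sharp_eq_comp_comul (A : H →ₗ[k] K) {α : H →ₗ[k] K} (hα : α ∈ coCocycles k H K) :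
    M.sharp A α = (LinearMap.mul' k K ∘ₗ TensorProduct.map A α -
      A ∘ₗ TensorProduct.lift M.act ∘ₗ TensorProduct.map LinearMap.id α) ∘ₗ comul := by
  rw [sharp, ← LinearMap.comp_assoc]
  congr 1
  ext f g
  simp [sharpAux, (mem_coCocycles.1 hα).1, TensorProduct.tmul_add, M.act_one,
    antipode_eq_neg_of_primitive ((mem_coCocycles.1 hα).1 g), sub_eq_add_neg]

lemma sharp_eq_convDeriv (A : H →ₗ[k] K) {α : H →ₗ[k] K} (hα : α ∈ coCocycles k H K) :
    M.sharp A α = convDeriv α (M.convAct LinearMap.id α) A := by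
  rw [sharp_eq_comp_comul M A hα, LinearMap.sub_comp]
  rfl

lemma counit_convAct_id {α : H →ₗ[k] K} (hα : α ∈ coCocycles k H K) (f : H) :
    counit (R := k) (M.convAct LinearMap.id α f) = 0 := by
  rw [M.convAct_apply _ _ (ℛ k f)]
  simp [counit_coCocycles_apply hα]

lemma convUnit_sharp_coCocycles {α : H →ₗ[k] K} (hα : α ∈ coCocycles k H K) :
    M.sharp (convUnit k H K) α = α := by
  have h : convUnit k H K ∘ₗ M.convAct LinearMap.id α = 0 := by
    ext f
    simp [convUnit, counit_convAct_id M hα]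
  rw [sharp_eq_convDeriv M _ hα, convDeriv_apply, h, sub_zero]
  exact congrArg ofConv (one_mul (toConv α))

lemma sharpPow_one {α : H →ₗ[k] K} (hα : α ∈ coCocycles k H K) : M.sharpPow α 1 = α :=
  M.convUnit_sharp_coCocycles hα

lemma counit_sharp {α : H →ₗ[k] K} (hα : α ∈ coCocycles k H K) (A : H →ₗ[k] K) (f : H) :
    counit (R := k) (M.sharp A α f) = -counit (R := k) (A (M.convAct LinearMap.id α f)) := by
  rw [sharp_eq_convDeriv M _ hα, convDeriv_apply]
  have : counit (R := k) ((toConv A * toConv α) f) = 0 := by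
    rw [(ℛ k f).convMul_apply]
    simp [Bialgebra.counit_mul, counit_coCocycles_apply hα]
  rw [LinearMap.sub_apply, map_sub]
  refine (congrArg (· - _) this).trans ?_
  rw [zero_sub]; rfl

lemma counit_sharpPow_succ {α : H →ₗ[k] K} (hα : α ∈ coCocycles k H K) (n : ℕ) (f : H) :
    counit (R := k) (M.sharpPow α (n + 1) f) = 0 := by
  induction n generalizing f with
  | zero => rw [sharpPow_one M hα, counit_coCocycles_apply hα]
  | succ n ih => rw [sharpPow, counit_sharp M hα, ih, neg_zero]

lemma sharpPow_succ_apply_one {α : H →ₗ[k] K} (hα : α ∈ coCocycles k H K) (n : ℕ) :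
    M.sharpPow α (n + 1) 1 = 0 := by
  rw [sharpPow, sharp_eq_comp_comul M _ hα]
  simp [Algebra.TensorProduct.one_def, (mem_coCocycles.1 hα).2]

/-- On `F (n + 1)`, the product `A # α` only depends on the restrictions to `F n` of maps `A` and
`α` which vanish at `1`. -/
lemma sharp_congr {α β A B : H →ₗ[k] K} (hα : α ∈ coCocycles k H K) (hβ : β ∈ coCocycles k H K)
    (hA : A 1 = 0) (hB : B 1 = 0) {n : ℕ} (h : ∀ f ∈ primFiltration k H n, α f = β f)
    (hAB : ∀ f ∈ primFiltration k H n, A f = B f) {f : H}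
    (hf : f ∈ primFiltration k H (n + 1)) : M.sharp A α f = M.sharp B β f := by
  rw [← sub_eq_zero, sharp_eq_comp_comul M A hα, sharp_eq_comp_comul M B hβ, ← LinearMap.sub_apply,
    ← LinearMap.sub_comp, LinearMap.comp_apply, ← Submodule.mem_bot k]
  refine map_comul_mem hf (fun x hx y hy => ?_) ?_
  · simp [h y hy, hAB x hx, hAB _ (M.act_mem_primFiltration hx _)]
  -- The terms from f ⊗ 1 vanish as α 1 = β 1 = 0. Those from 1 ⊗ f vanish as A 1 = B 1 = 0 and 1 ◁
  -- α f = ε(α f) 1 = 0, and likewise for β.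
  · simp [(mem_coCocycles.1 hα).2, (mem_coCocycles.1 hβ).2, hA, hB, counit_coCocycles_apply hα,
      counit_coCocycles_apply hβ]

lemma sharpPow_congr {α β : H →ₗ[k] K} (hα : α ∈ coCocycles k H K) (hβ : β ∈ coCocycles k H K)
    {n : ℕ} (h : ∀ f ∈ primFiltration k H n, α f = β f) (m : ℕ) {f : H}
    (hf : f ∈ primFiltration k H n) : M.sharpPow α m f = M.sharpPow β m f := by
  induction n generalizing m f with
  | zero =>
    obtain ⟨c, rfl⟩ := Submodule.mem_span_singleton.1 hf
    cases m with
    | zero => rfl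
    | succ m => rw [map_smul, map_smul, M.sharpPow_succ_apply_one hα, M.sharpPow_succ_apply_one hβ]
  | succ n ih =>
    have h' : ∀ f ∈ primFiltration k H n, α f = β f := fun f hf => h f (primFiltration_le_succ n hf)
    -- Exponents 0 and 1 are separate: `sharp_congr` needs a left factor vanishing at 1, which
    -- α^{#0} does not.
    match m with
    | 0 => rfl
    | 1 => rw [M.sharpPow_one hα, M.sharpPow_one hβ, h f hf]
    | m + 2 =>
      exact M.sharp_congr hα hβ (M.sharpPow_succ_apply_one hα m) (M.sharpPow_succ_apply_one hβ m) h'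
        (fun f hf => ih h' (m + 1) hf) hf

lemma sharpPow_add_two_congr {α β : H →ₗ[k] K} (hα : α ∈ coCocycles k H K)
    (hβ : β ∈ coCocycles k H K) {n : ℕ} (h : ∀ f ∈ primFiltration k H n, α f = β f) (m : ℕ) {f : H}
    (hf : f ∈ primFiltration k H (n + 1)) :
    M.sharpPow α (m + 2) f = M.sharpPow β (m + 2) f :=
  M.sharp_congr hα hβ (M.sharpPow_succ_apply_one hα m) (M.sharpPow_succ_apply_one hβ m) h
    (fun _ hf => M.sharpPow_congr hα hβ h (m + 1) hf) hf

lemma sharpPow_eq_zero {α : H →ₗ[k] K} (hα : α ∈ coCocycles k H K) {n m : ℕ} (hnm : n < m) {f : H}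
    (hf : f ∈ primFiltration k H n) : M.sharpPow α m f = 0 := by
  induction n generalizing m f with
  | zero =>
    obtain ⟨m, rfl⟩ := Nat.exists_eq_succ_of_ne_zero hnm.ne'
    obtain ⟨c, rfl⟩ := Submodule.mem_span_singleton.1 hf
    rw [map_smul, M.sharpPow_succ_apply_one hα, smul_zero]
  | succ n ih =>
    obtain ⟨m, rfl⟩ := Nat.exists_eq_succ_of_ne_zero (Nat.ne_zero_of_lt hnm)
    have h0 : ∀ f ∈ primFiltration k H n, M.sharpPow α m f = 0 := fun f hf => ih (by omega) hf
    -- Compare with 0 # α = 0, since α^{#m} already vanishes on F n.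
    refine (M.sharp_congr hα hα (h0 1 (one_mem_primFiltration n)) (LinearMap.zero_apply (1 : H))
      (fun _ _ => rfl) h0 hf).trans ?_
    rw [M.sharp_eq_convDeriv _ hα, map_zero, LinearMap.zero_apply]

lemma locallyNilpotent (hH : IsConilpotent k H) {α : H →ₗ[k] K} (hα : α ∈ coCocycles k H K) :
    M.LocallyNilpotent α := fun f => by
  obtain ⟨n, hn⟩ := hH f
  refine (Set.finite_Iic n).subset fun m hm => ?_
  by_contra h
  exact hm (M.sharpPow_eq_zero hα (not_le.1 h) hn)

lemma expSharp_apply (hH : IsConilpotent k H) {α : H →ₗ[k] K} (hα : α ∈ coCocycles k H K) {n N : ℕ}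
    (hN : n < N) {f : H} (hf : f ∈ primFiltration k H n) :
    M.expSharp α f = ∑ m ∈ Finset.range N, ((m.factorial : k)⁻¹) • M.sharpPow α m f := by
  rw [expSharp, dif_pos (M.locallyNilpotent hH hα)]
  refine finsum_eq_sum_of_support_subset _ fun m hm => ?_
  by_contra h
  refine hm ?_
  have hm' : N ≤ m := by simpa using h
  simp only [M.sharpPow_eq_zero hα (hN.trans_le hm') hf, smul_zero]

/-- The Leibniz rule for A ↦ A # α turns each term (i, j) into (i + 1, j) plus (i, j + 1), and
Pascal's rule concludes. -/
lemma comul_comp_sharpPow [IsCocomm k H] {α : H →ₗ[k] K} (hα : α ∈ coCocycles k H K) (n : ℕ) :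
    comul ∘ₗ M.sharpPow α n = ∑ p ∈ Finset.HasAntidiagonal.antidiagonal n,
      n.choose p.1 • (TensorProduct.map (M.sharpPow α p.1) (M.sharpPow α p.2) ∘ₗ comul) := by
  induction n with
  | zero =>
    rw [Finset.HasAntidiagonal.antidiagonal_zero, Finset.sum_singleton, Nat.choose_self, one_smul]
    exact (convOneCoalgHom (R := k) (C := H) (K := K)).map_comp_comul.symm
  | succ n ih =>
    have h : comul ∘ₗ M.sharp (M.sharpPow α n) α =
        convDeriv (comul ∘ₗ α) (M.convAct LinearMap.id α) (comul ∘ₗ M.sharpPow α n) := by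
      rw [M.sharp_eq_convDeriv _ hα]
      exact algHom_comp_convDeriv (Bialgebra.comulAlgHom k K) _ _ _
    rw [Finset.sum_antidiagonal_choose_succ_nsmul (fun i j =>
      TensorProduct.map (M.sharpPow α i) (M.sharpPow α j) ∘ₗ comul (R := k)), sharpPow, h, ih,
      map_sum, add_comm, ← Finset.sum_add_distrib]
    refine Finset.sum_congr rfl fun p hp => ?_
    rw [map_nsmul, comul_comp_coCocycles hα, convDeriv_map_comp_comul
      (M.comul_comp_convAct_id α (mem_coCocycles.1 hα).1), ← M.sharp_eq_convDeriv _ hα,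
      ← M.sharp_eq_convDeriv _ hα,
      Nat.choose_symm_of_eq_add (Finset.HasAntidiagonal.mem_antidiagonal.1 hp).symm,
      nsmul_add]
    rfl

end RightHopfModule

/-! ### The exponential and its bijectivity -/

lemma sum_range_sum_antidiagonal_of_support {V : Type*} [AddCommMonoid V] {g : ℕ × ℕ → V} {N : ℕ}
    (hg : ∀ p, N ≤ p.1 ∨ N ≤ p.2 → g p = 0) :
    ∑ m ∈ Finset.range (2 * N), ∑ p ∈ Finset.HasAntidiagonal.antidiagonal m, g p =
      ∑ p ∈ Finset.range N ×ˢ Finset.range N, g p := by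
  -- The bound 2 * N makes the triangle of antidiagonals cover the whole N × N square.
  rw [← Finset.sum_fiberwise_of_maps_to (t := Finset.range (2 * N))
    (g := fun p : ℕ × ℕ => p.1 + p.2)
    (fun p hp => by simp only [Finset.mem_product, Finset.mem_range] at hp ⊢; omega)]
  refine Finset.sum_congr rfl fun m _ => (Finset.sum_subset ?_ fun p hp hp' => hg p ?_).symm
  · intro p hp
    simpa using (Finset.mem_filter.1 hp).2
  · have := Finset.HasAntidiagonal.mem_antidiagonal.1 hp
    by_contra! h
    exact hp' (by simp [this, h.1, h.2])

lemma inv_factorial_smul_choose_nsmul [CharZero k] {V : Type*} [AddCommGroup V] [Module k V]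
    {n i j : ℕ} (h : i + j = n) (v : V) :
    ((n.factorial : k)⁻¹) • (n.choose i • v) =
      ((i.factorial : k)⁻¹ * (j.factorial : k)⁻¹) • v := by
  subst h
  have h : ((i + j).choose i : k) * i.factorial * j.factorial = (i + j).factorial := by
    have := Nat.choose_mul_factorial_mul_factorial (Nat.le_add_right i j)
    rw [Nat.add_sub_cancel_left] at this
    exact_mod_cast this
  rw [← Nat.cast_smul_eq_nsmul k, smul_smul, ← h]
  congr 1
  have hi : (i.factorial : k) ≠ 0 := Nat.cast_ne_zero.2 i.factorial_ne_zero
  have hj : (j.factorial : k) ≠ 0 := Nat.cast_ne_zero.2 j.factorial_ne_zero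
  have hc : ((i + j).choose i : k) ≠ 0 :=
    Nat.cast_ne_zero.2 (Nat.choose_pos (Nat.le_add_right i j)).ne'
  field_simp

namespace RightHopfModule

variable (M : RightHopfModule k H K)

lemma counit_expSharp (hH : IsConilpotent k H) {α : H →ₗ[k] K} (hα : α ∈ coCocycles k H K)
    (f : H) : counit (R := k) (M.expSharp α f) = counit (R := k) f := by
  obtain ⟨n, hn⟩ := hH f
  rw [M.expSharp_apply hH hα n.lt_succ_self hn, Finset.sum_range_succ', map_add, map_sum,
    Finset.sum_eq_zero fun m _ => by
      rw [map_smul, M.counit_sharpPow_succ hα, smul_zero]]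
  simp [sharpPow, convUnit]

lemma comul_expSharp [CharZero k] [IsCocomm k H] (hH : IsConilpotent k H) {α : H →ₗ[k] K}
    (hα : α ∈ coCocycles k H K) (f : H) :
    comul (M.expSharp α f) =
      TensorProduct.map (M.expSharp α) (M.expSharp α) (comul (R := k) f) := by
  obtain ⟨n, hn⟩ := hH f
  set N := n + 1
  let g : ℕ × ℕ → H ⊗[k] H →ₗ[k] K ⊗[k] K := fun p =>
    ((p.1.factorial : k)⁻¹ * (p.2.factorial : k)⁻¹) •
      TensorProduct.map (M.sharpPow α p.1) (M.sharpPow α p.2)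
  -- Δ f lies in F n ⊗ F n, where powers of exponent at least N = n + 1 vanish on either factor.
  have hg : ∀ p, N ≤ p.1 ∨ N ≤ p.2 → g p (comul f) = 0 := fun p hp => by
    rw [← Submodule.mem_bot k]
    refine map_range_map_subtype_mem (fun x hx y hy => ?_) (comul_mem_range_map_subtype hn)
    rcases hp with hp | hp
    · simp [g, M.sharpPow_eq_zero hα hp hx]
    · simp [g, M.sharpPow_eq_zero hα hp hy]
  have hleft : comul (M.expSharp α f) = ∑ m ∈ Finset.range (2 * N),
      ∑ p ∈ Finset.HasAntidiagonal.antidiagonal m, g p (comul f) := by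
    rw [M.expSharp_apply hH hα (show n < 2 * N by omega) hn, map_sum]
    refine Finset.sum_congr rfl fun m _ => ?_
    have h := LinearMap.congr_fun (M.comul_comp_sharpPow hα m) f
    rw [LinearMap.comp_apply, LinearMap.sum_apply] at h
    rw [map_smul, h, Finset.smul_sum]
    exact Finset.sum_congr rfl fun p hp =>
      inv_factorial_smul_choose_nsmul (Finset.HasAntidiagonal.mem_antidiagonal.1 hp) _
  rw [hleft, sum_range_sum_antidiagonal_of_support hg, ← sub_eq_zero, ← LinearMap.sum_apply,
    ← LinearMap.sub_apply, ← Submodule.mem_bot k]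
  refine map_range_map_subtype_mem (fun x hx y hy => ?_) (comul_mem_range_map_subtype hn)
  rw [Submodule.mem_bot, LinearMap.sub_apply, sub_eq_zero, LinearMap.sum_apply,
    TensorProduct.map_tmul, M.expSharp_apply hH hα n.lt_succ_self hx,
    M.expSharp_apply hH hα n.lt_succ_self hy, Finset.sum_product, TensorProduct.sum_tmul]
  simp only [TensorProduct.tmul_sum, g, LinearMap.smul_apply, TensorProduct.map_tmul,
    TensorProduct.smul_tmul_smul]
  rfl

/-- The exponential of a co-cocycle as a coalgebra morphism. -/
def expSharpCoalgHom [CharZero k] [IsCocomm k H] (hH : IsConilpotent k H) {α : H →ₗ[k] K}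
    (hα : α ∈ coCocycles k H K) : H →ₗc[k] K where
  toLinearMap := M.expSharp α
  counit_comp := LinearMap.ext (M.counit_expSharp hH hα)
  map_comp_comul := LinearMap.ext fun f => (M.comul_expSharp hH hα f).symm

lemma expSharp_apply_one (hH : IsConilpotent k H) {α : H →ₗ[k] K} (hα : α ∈ coCocycles k H K) :
    M.expSharp α 1 = 1 := by
  rw [M.expSharp_apply hH hα zero_lt_one (one_mem_primFiltration 0)]
  simp [sharpPow, convUnit]

lemma expSharp_congr (hH : IsConilpotent k H) {α β : H →ₗ[k] K} (hα : α ∈ coCocycles k H K)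
    (hβ : β ∈ coCocycles k H K) {n : ℕ} (h : ∀ f ∈ primFiltration k H n, α f = β f) {f : H}
    (hf : f ∈ primFiltration k H n) : M.expSharp α f = M.expSharp β f := by
  rw [M.expSharp_apply hH hα n.lt_succ_self hf, M.expSharp_apply hH hβ n.lt_succ_self hf]
  exact Finset.sum_congr rfl fun m _ => by rw [M.sharpPow_congr hα hβ h m hf]

/-- If `α` and `β` agree on `F n`, then `exp α - exp β = α - β` on `F (n + 1)`. -/
lemma expSharp_sub_expSharp (hH : IsConilpotent k H) {α β : H →ₗ[k] K}
    (hα : α ∈ coCocycles k H K) (hβ : β ∈ coCocycles k H K) {n : ℕ}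
    (h : ∀ f ∈ primFiltration k H n, α f = β f) {f : H} (hf : f ∈ primFiltration k H (n + 1)) :
    M.expSharp α f - M.expSharp β f = α f - β f := by
  -- Exponents at least 2 agree on F (n + 1), exponent 0 cancels, and exponent 1 leaves α - β.
  rw [M.expSharp_apply hH hα (Nat.lt_succ_self (n + 1)) hf,
    M.expSharp_apply hH hβ (Nat.lt_succ_self (n + 1)) hf, Finset.sum_range_succ',
    Finset.sum_range_succ', Finset.sum_range_succ', Finset.sum_range_succ',
    Finset.sum_congr rfl fun m _ => by rw [M.sharpPow_add_two_congr hα hβ h m hf]]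
  simp [M.convUnit_sharp_coCocycles hα, M.convUnit_sharp_coCocycles hβ, sharpPow]

lemma expSharp_injOn (hH : IsConilpotent k H) :
    Set.InjOn M.expSharp (coCocycles k H K : Set (H →ₗ[k] K)) := by
  intro α hα β hβ hαβ
  have h : ∀ n, ∀ f ∈ primFiltration k H n, α f = β f := fun n => by
    induction n with
    | zero =>
      intro f hf
      rw [coCocycles_apply_eq_zero hα hf, coCocycles_apply_eq_zero hβ hf]
    | succ n ih =>
      intro f hf
      have := M.expSharp_sub_expSharp hH hα hβ ih hf
      rwa [hαβ, sub_self, eq_comm, sub_eq_zero] at this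
  ext f
  obtain ⟨n, hn⟩ := hH f
  exact h n f hn

/-- Two coalgebra morphisms which agree on `F n` differ by primitive elements on `F (n + 1)`. -/
lemma comul_sub_of_eqOn (hK : IsConilpotent k K) {X Y : H →ₗc[k] K} {n : ℕ}
    (h : ∀ f ∈ primFiltration k H n, X f = Y f) {f : H} (hf : f ∈ primFiltration k H (n + 1)) :
    comul (R := k) (X f - Y f) = 1 ⊗ₜ (X f - Y f) + (X f - Y f) ⊗ₜ 1 := by
  have h1 : TensorProduct.map (X : H →ₗ[k] K) (X : H →ₗ[k] K) (reducedComul k H f) -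
      TensorProduct.map (Y : H →ₗ[k] K) (Y : H →ₗ[k] K) (reducedComul k H f) = 0 := by
    rw [← LinearMap.sub_apply, ← Submodule.mem_bot k]
    refine map_range_map_subtype_mem (fun x hx y hy => ?_) (mem_primFiltration_succ.1 hf)
    simp [h x hx, h y hy]
  simp only [reducedComul_apply, map_add, map_sub, map_smul, TensorProduct.map_tmul,
    CoalgHomClass.map_comp_comul_apply, CoalgHom.coe_toLinearMap, coalgHom_map_one hK] at h1
  rw [map_sub, TensorProduct.tmul_sub, TensorProduct.sub_tmul, ← sub_eq_zero, ← h1]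
  abel

lemma exists_coCocycle_extension [CharZero k] [IsCocomm k H] (hH : IsConilpotent k H)
    (hK : IsConilpotent k K) (T : H →ₗc[k] K) {n : ℕ} {α : H →ₗ[k] K}
    (hα : α ∈ coCocycles k H K) (h : ∀ f ∈ primFiltration k H n, M.expSharp α f = T f) :
    ∃ β ∈ coCocycles k H K, (∀ f ∈ primFiltration k H n, β f = α f) ∧
      ∀ f ∈ primFiltration k H (n + 1), M.expSharp β f = T f := by
  -- Any linear retraction p onto F (n + 1) will do: being primitive is checked value by value, so p
  -- need not respect the coproduct.
  obtain ⟨p, hp⟩ := LinearMap.exists_leftInverse_of_injective (primFiltration k H (n + 1)).subtype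
    (Submodule.ker_subtype _)
  have hp' : ∀ f (hf : f ∈ primFiltration k H (n + 1)), (p f : H) = f := fun f hf =>
    congrArg Subtype.val (LinearMap.congr_fun hp ⟨f, hf⟩)
  set γ : H →ₗ[k] K := ((T : H →ₗ[k] K) - M.expSharp α) ∘ₗ
    (primFiltration k H (n + 1)).subtype ∘ₗ p with hγdef
  have hγ' : ∀ f ∈ primFiltration k H (n + 1), γ f = T f - M.expSharp α f := fun f hf => by
    simp [hγdef, hp' f hf]
  have hγ : γ ∈ coCocycles k H K := by
    refine mem_coCocycles.2 ⟨fun f => ?_, ?_⟩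
    · exact comul_sub_of_eqOn (Y := M.expSharpCoalgHom hH hα) hK (fun f hf => (h f hf).symm) (p f).2
    · rw [hγ' 1 (one_mem_primFiltration _), M.expSharp_apply_one hH hα, coalgHom_map_one hK,
        sub_self]
  have hβ : α + γ ∈ coCocycles k H K := Submodule.add_mem _ hα hγ
  have hβα : ∀ f ∈ primFiltration k H n, (α + γ) f = α f := fun f hf => by
    rw [LinearMap.add_apply, hγ' f (primFiltration_le_succ n hf), h f hf, sub_self, add_zero]
  refine ⟨α + γ, hβ, hβα, fun f hf => ?_⟩
  have h1 := M.expSharp_sub_expSharp hH hβ hα hβα hf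
  rw [LinearMap.add_apply, hγ' f hf, add_sub_cancel_left] at h1
  exact sub_left_inj.1 h1

/-- A sequence of co-cocycles, each extending the previous one on the filtration, has a limit. -/
lemma exists_coCocycle_limit (hH : IsConilpotent k H) {a : ℕ → H →ₗ[k] K}
    (ha : ∀ n, a n ∈ coCocycles k H K)
    (hsucc : ∀ n, ∀ f ∈ primFiltration k H n, a (n + 1) f = a n f) :
    ∃ α ∈ coCocycles k H K, ∀ n, ∀ f ∈ primFiltration k H n, α f = a n f := by
  have hle : ∀ {n m}, n ≤ m → ∀ f ∈ primFiltration k H n, a m f = a n f := fun {n m} hnm => by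
    induction m, hnm using Nat.le_induction with
    | base => exact fun _ _ => rfl
    | succ m hnm ih =>
      exact fun f hf => (hsucc m f (primFiltration_mono hnm hf)).trans (ih f hf)
  choose N hN using hH
  have hval : ∀ n, ∀ f ∈ primFiltration k H n, a (N f) f = a n f := fun n f hf =>
    (hle (le_max_left (N f) n) f (hN f)).symm.trans (hle (le_max_right (N f) n) f hf)
  let α : H →ₗ[k] K :=
    { toFun := fun f => a (N f) f
      map_add' := fun f g => by
        have hf := primFiltration_mono (le_max_left (N f) (N g)) (hN f)
        have hg := primFiltration_mono (le_max_right (N f) (N g)) (hN g)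
        rw [hval _ f hf, hval _ g hg, hval _ _ (Submodule.add_mem _ hf hg), map_add]
      map_smul' := fun c f => by
        rw [hval _ _ (Submodule.smul_mem _ c (hN f)), map_smul, RingHom.id_apply] }
  exact ⟨α, mem_coCocycles.2 ⟨fun f => (mem_coCocycles.1 (ha (N f))).1 f,
    (mem_coCocycles.1 (ha (N 1))).2⟩, hval⟩

lemma exists_expSharp_eq [CharZero k] [IsCocomm k H] (hH : IsConilpotent k H)
    (hK : IsConilpotent k K) (T : H →ₗc[k] K) :
    ∃ α ∈ coCocycles k H K, M.expSharp α = (T : H →ₗ[k] K) := by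
  -- Bundling agreement with T on F n lets each approximation feed the next extension in a dependent
  -- choice.
  let S (n : ℕ) : Type _ := {α : H →ₗ[k] K // α ∈ coCocycles k H K ∧
    ∀ f ∈ primFiltration k H n, M.expSharp α f = T f}
  have hstep : ∀ n (s : S n), ∃ t : S (n + 1), ∀ f ∈ primFiltration k H n, t.1 f = s.1 f := by
    rintro n ⟨α, hα, h⟩
    obtain ⟨β, hβ, hβα, hβT⟩ := M.exists_coCocycle_extension hH hK T hα h
    exact ⟨⟨β, hβ, hβT⟩, hβα⟩
  choose next hnext using hstep
  have h0 : ∀ f ∈ primFiltration k H 0, M.expSharp 0 f = T f := fun f hf => by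
    obtain ⟨c, rfl⟩ := Submodule.mem_span_singleton.1 hf
    rw [map_smul, map_smul, M.expSharp_apply_one hH (Submodule.zero_mem _), coalgHom_map_one hK]
  let s : ∀ n, S n := Nat.rec ⟨0, Submodule.zero_mem _, h0⟩ next
  obtain ⟨α, hα, hαs⟩ := exists_coCocycle_limit hH (a := fun n => (s n).1) (fun n => (s n).2.1)
    fun n => hnext n (s n)
  refine ⟨α, hα, LinearMap.ext fun f => ?_⟩
  obtain ⟨n, hn⟩ := hH f
  exact (M.expSharp_congr hH hα (s n).2.1 (hαs n) hn).trans ((s n).2.2 f hn)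

end RightHopfModule

end HopfExp

end

theorem mainTheorem8 {k : Type*} {H : Type*} {K : Type*} [Field k] [CharZero k]
    [Ring H] [HopfAlgebra k H] [Coalgebra.IsCocomm k H]
    [Ring K] [HopfAlgebra k K] [Coalgebra.IsCocomm k K]
    (hH : HopfExp.IsConilpotent k H) (hK : HopfExp.IsConilpotent k K)
    (M : HopfExp.RightHopfModule k H K) :
    (∃ _ : Group (HopfExp.coalgMorphisms k H K),
      (∀ A B : HopfExp.coalgMorphisms k H K,
        ((A * B : HopfExp.coalgMorphisms k H K) : H →ₗ[k] K) =
          M.sharp (A : H →ₗ[k] K) (B : H →ₗ[k] K)) ∧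
      ((1 : HopfExp.coalgMorphisms k H K) : H →ₗ[k] K) = HopfExp.convUnit k H K) ∧
    (∀ α ∈ HopfExp.coCocycles k H K, M.LocallyNilpotent α) ∧
    Set.BijOn M.expSharp (HopfExp.coCocycles k H K : Set (H →ₗ[k] K))
      (HopfExp.coalgMorphisms k H K) := by
  refine ⟨⟨M.coalgMorphismsGroup hH hK, fun A B => rfl, rfl⟩,
    fun α hα => M.locallyNilpotent hH hα, fun α hα => ⟨M.expSharpCoalgHom hH hα, rfl⟩,
    M.expSharp_injOn hH, ?_⟩
  rintro _ ⟨T, rfl⟩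
  exact M.exists_expSharp_eq hH hK T
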